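/- Let $(M,\rho,\mu)$ be a metric probability space. For $n\ge 1$ and $r\ge 0$, let $G_M(n,r)$ be the random graph on the vertex set $[n]=\{1,\dots,n\}$ obtained by sampling $x_1,\dots,x_n\in M$ independently from $\mu$ and joining distinct $i,j$ exactly when $\rho(x_i,x_j)\le r$. A monotone graph property on $[n]$ is a family $\mathcal F$ of graphs on $[n]$ that is closed under adding edges (it need not be invariant under relabelling the vertices); it is nontrivial if it is neither empty nor the family of all graphs on $[n]$, which forces $n\ge 2$. A sequence of positive radii $(r_n)$ is a threshold for a sequence $(\mathcal F_n)_{n\ge 2}$ of nontrivial monotone properties, $\mathcal F_n$ being a property on $[n]$, if for every sequence of radii $s_n\ge 0$, as $n\to\infty$, $$\mathbb P\bigl(G_M(n,s_n)\in\mathcal F_n\bigr)\to\begin{cases}0&\text{if } s_n/r_n\to 0,\\ 1&\text{if } s_n/r_n\to\infty.\end{cases}$$ The space $(M,\rho,\mu)$ admits thresholds if every sequence $(\mathcal F_n)_{n\ge2}$ of nontrivial monotone properties has a threshold. Theorem. For every integer $d\ge 1$, the flat torus $\mathbb T^d=\mathbb R^d/\mathbb Z^d$, with the metric $\rho(x,y)=\bigl(\sum_{i=1}^d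 \|x_i-y_i\|^2\bigr)^{1/2}$, where $\|t\|$ is the distance from $t$ to the nearest integer, and with normalised Haar measure, admits thresholds. -/

import Mathlib

open Filter Topology MeasureTheory
open scoped ENNReal

/-- The geometric graph of the configuration `x` at radius `r`: distinct `i` and `j` are joined
when `dist (x i) (x j) ≤ r`. -/
def geometricGraph {M : Type*} [MetricSpace M] {n : ℕ} (x : Fin n → M) (r : ℝ) :
    SimpleGraph (Fin n) where
  Adj i j := i ≠ j ∧ dist (x i) (x j) ≤ r
  symm := ⟨fun _ _ h => ⟨h.1.symm, by simpa only [dist_comm] using h.2⟩⟩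
  loopless := ⟨fun _ h => h.1 rfl⟩

/-- A nontrivial monotone property of graphs on `n` labelled vertices: a family of graphs closed
under adding edges that is neither empty nor the family of all graphs. It need not be invariant
under relabelling. -/
structure IsNontrivialMonotone {n : ℕ} (F : Set (SimpleGraph (Fin n))) : Prop where
  monotone : IsUpperSet F
  ne_empty : F ≠ ∅
  ne_univ : F ≠ Set.univ

/-- The probability that the random geometric graph on `n` points sampled independently from `μ`,
at radius `r`, belongs to `F`. -/
noncomputable def geometricProb {M : Type*} [MetricSpace M] [MeasurableSpace M] (μ : Measure M)
    [IsProbabilityMeasure μ] {n : ℕ} (F : Set (SimpleGraph (Fin n))) (r : ℝ) : ℝ≥0∞ :=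
  Measure.pi (fun _ : Fin n => μ) {x | geometricGraph x r ∈ F}

/-- The sequence of (positive) radii `r` is a threshold for the sequence of properties `F`. -/
structure IsThreshold {M : Type*} [MetricSpace M] [MeasurableSpace M] (μ : Measure M)
    [IsProbabilityMeasure μ] (F : ∀ n : ℕ, Set (SimpleGraph (Fin n))) (r : ℕ → ℝ) : Prop where
  pos : ∀ n, 0 < r n
  zero_statement : ∀ s : ℕ → ℝ, (∀ n, 0 ≤ s n) → Tendsto (fun n => s n / r n) atTop (𝓝 0) →
    Tendsto (fun n => geometricProb μ (F n) (s n)) atTop (𝓝 0)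
  one_statement : ∀ s : ℕ → ℝ, (∀ n, 0 ≤ s n) → Tendsto (fun n => s n / r n) atTop atTop →
    Tendsto (fun n => geometricProb μ (F n) (s n)) atTop (𝓝 1)

/-- The metric probability space `(M, dist, μ)` admits thresholds: every sequence of nontrivial
monotone properties has a threshold. Since there is only one graph on `n ≤ 1` vertices, nontrivial
properties exist only for `n ≥ 2`, and this is where the sequence starts. -/
def AdmitsThresholds (M : Type*) [MetricSpace M] [MeasurableSpace M] (μ : Measure M)
    [IsProbabilityMeasure μ] : Prop :=
  ∀ F : ∀ n : ℕ, Set (SimpleGraph (Fin n)), (∀ n, 2 ≤ n → IsNontrivialMonotone (F n)) →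
    ∃ r : ℕ → ℝ, IsThreshold μ F r

/-- The flat torus `ℝ^d / ℤ^d`, as the `ℓ²` product of `d` circles `ℝ / ℤ`. Its distance is
`√(∑ i, ‖x i - y i‖²)`, where `‖·‖` is the distance to the nearest integer. -/
abbrev FlatTorus (d : ℕ) : Type := PiLp 2 (fun _ : Fin d => UnitAddCircle)

instance FlatTorus.compactSpace (d : ℕ) : CompactSpace (FlatTorus d) :=
  (PiLp.homeomorph 2 (fun _ : Fin d => UnitAddCircle)).symm.compactSpace

/-- The normalised Haar measure on the flat torus. -/
noncomputable def torusHaar (d : ℕ) : Measure (FlatTorus d) := Measure.addHaarMeasure ⊤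

instance torusHaar.isProbabilityMeasure (d : ℕ) : IsProbabilityMeasure (torusHaar d) :=
  ⟨Measure.addHaarMeasure_self (K₀ := (⊤ : TopologicalSpace.PositiveCompacts (FlatTorus d)))⟩

/-! Fold every coordinate of the torus at a common random point `θ` by the tent map `t ↦
2‖t - θ‖`. The fold preserves Haar measure and at most doubles distances. So if `A` is the set of
configurations whose graph at radius `r` lies in `F`, then the set of configurations whose folded
graph at radius `2r` lies in `F` has measure `P(2r)` and contains every image of `A` under
reflecting an arbitrary set of coordinates at `θ`. Averaging a function over these reflections
halves its variance, in the mean over `θ`: on the circle this is a direct computation, and the law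
of total variance carries it over to products with a common `θ`. Applied to the indicator of `A`,
Cauchy–Schwarz then shows that doubling the radius at least doubles the odds `P / (1 - P)`. The
radius at which the odds cross `1` is therefore a threshold. -/

open ProbabilityTheory

section Variance

variable {X Y E : Type*} [MeasurableSpace X] [MeasurableSpace Y] [MeasurableSpace E]
  {μ : Measure X} {ν : Measure Y} {τ : Measure E}

/-- Bounded measurable real functions: unlike the square integrable ones, they are stable under
composition with an arbitrary measurable map. -/
structure IsBoundedMeasurable (h : X → ℝ) : Prop where
  measurable : Measurable h
  bounded : ∃ C, ∀ x, |h x| ≤ C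

namespace IsBoundedMeasurable

variable {h : X → ℝ}

theorem comp (hh : IsBoundedMeasurable h) {f : Y → X} (hf : Measurable f) :
    IsBoundedMeasurable fun y => h (f y) where
  measurable := hh.measurable.comp hf
  bounded := hh.bounded.imp fun _ hC y => hC (f y)

theorem indicator_one {A : Set X} (hA : MeasurableSet A) :
    IsBoundedMeasurable (A.indicator (1 : X → ℝ)) where
  measurable := measurable_one.indicator hA
  bounded := ⟨1, fun x => by by_cases hx : x ∈ A <;> simp [hx]⟩

theorem memLp (hh : IsBoundedMeasurable h) (μ : Measure X) [IsFiniteMeasure μ] (p : ℝ≥0∞) :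
    MemLp h p μ :=
  have ⟨C, hC⟩ := hh.bounded
  MemLp.of_bound hh.measurable.aestronglyMeasurable C (ae_of_all _ hC)

theorem integrable (hh : IsBoundedMeasurable h) (μ : Measure X) [IsFiniteMeasure μ] :
    Integrable h μ :=
  memLp_one_iff_integrable.1 (hh.memLp μ 1)

theorem integral_snd [IsFiniteMeasure ν] {h : X × Y → ℝ} (hh : IsBoundedMeasurable h) :
    IsBoundedMeasurable fun x => ∫ y, h (x, y) ∂ν where
  measurable := hh.measurable.stronglyMeasurable.integral_prod_right'.measurable
  bounded :=
    have ⟨C, hC⟩ := hh.bounded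
    ⟨C * ν.real Set.univ, fun x =>
      norm_integral_le_of_norm_le_const (f := fun y => h (x, y)) (ae_of_all _ fun y => hC (x, y))⟩

end IsBoundedMeasurable

theorem measurable_evariance_snd [SFinite ν] {h : X × Y → ℝ} (hh : Measurable h) :
    Measurable fun x => eVar[fun y => h (x, y); ν] :=
  have hmean : Measurable fun x => ∫ y, h (x, y) ∂ν :=
    hh.stronglyMeasurable.integral_prod_right'.measurable
  ((hh.sub (hmean.comp measurable_fst)).enorm.pow_const 2).lintegral_prod_right'

theorem measurable_evariance_fst [SFinite ν] {h : Y × X → ℝ} (hh : Measurable h) :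
    Measurable fun x => eVar[fun y => h (y, x); ν] :=
  measurable_evariance_snd (h := fun z : X × Y => h z.swap) (hh.comp measurable_swap)

theorem lintegral_enorm_sub_sq [IsProbabilityMeasure μ] {h : X → ℝ} (hh : MemLp h 2 μ) (c : ℝ) :
    ∫⁻ x, ‖h x - c‖ₑ ^ 2 ∂μ = eVar[h; μ] + ‖μ[h] - c‖ₑ ^ 2 := by
  have hsub : MemLp (fun x => h x - c) 2 μ := hh.sub (memLp_const c)
  have hmean : ∫ x, h x - c ∂μ = μ[h] - c := by
    rw [integral_sub (hh.integrable one_le_two) (integrable_const c), integral_const, probReal_univ,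
      one_smul]
  have hvar : ∫ x, (h x - c) ^ 2 ∂μ = Var[h; μ] + (μ[h] - c) ^ 2 := by
    have := variance_eq_sub hsub
    rw [variance_sub_const hh.aestronglyMeasurable, hmean] at this
    simp only [Pi.pow_apply] at this
    linarith
  simp only [← enorm_pow]
  simp_rw [Real.enorm_of_nonneg (sq_nonneg _)]
  rw [← ofReal_integral_eq_lintegral_ofReal hsub.integrable_sq (ae_of_all _ fun _ => sq_nonneg _),
    hvar, ENNReal.ofReal_add (variance_nonneg _ _) (sq_nonneg _), hh.ofReal_variance_eq]

theorem evariance_prod [IsProbabilityMeasure μ] [IsProbabilityMeasure ν] {h : Y × X → ℝ}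
    (hh : IsBoundedMeasurable h) :
    eVar[h; ν.prod μ] =
      ∫⁻ x, eVar[fun y => h (y, x); ν] ∂μ + eVar[fun x => ∫ y, h (y, x) ∂ν; μ] := by
  have hslice x : IsBoundedMeasurable fun y => h (y, x) := hh.comp measurable_prodMk_right
  have hmean : ∫ z, h z ∂ν.prod μ = ∫ x, ∫ y, h (y, x) ∂ν ∂μ :=
    integral_prod_symm h (hh.integrable _)
  rw [evariance, lintegral_prod_symm' _ ((hh.measurable.sub_const _).enorm.pow_const 2)]
  simp_rw [fun x => lintegral_enorm_sub_sq ((hslice x).memLp ν 2)]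
  rw [lintegral_add_left (measurable_evariance_fst hh.measurable), hmean]
  rfl

theorem sq_lintegral_le_measure_support_mul {f : X → ℝ≥0∞} (hf : Measurable f) :
    (∫⁻ x, f x ∂μ) ^ 2 ≤ μ f.support * ∫⁻ x, f x ^ 2 ∂μ := by
  have hmul : f.support.indicator (1 : X → ℝ≥0∞) * f = f := by
    ext x
    by_cases hx : f x = 0 <;> simp [hx]
  have hindicator x : f.support.indicator (1 : X → ℝ≥0∞) x ^ (2 : ℝ) = f.support.indicator 1 x := by
    by_cases hx : f x = 0 <;> simp [hx]
  have hsq (a : ℝ≥0∞) : (a ^ (1 / 2 : ℝ)) ^ 2 = a := by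
    rw [← ENNReal.rpow_natCast, ← ENNReal.rpow_mul]
    norm_num
  have hholder := ENNReal.lintegral_mul_le_Lp_mul_Lq μ Real.HolderConjugate.two_two
    (measurable_one.indicator (measurableSet_support hf)).aemeasurable hf.aemeasurable
  simp only [hmul, hindicator, lintegral_indicator_one (measurableSet_support hf),
    ENNReal.rpow_two] at hholder
  calc (∫⁻ x, f x ∂μ) ^ 2
      ≤ (μ f.support ^ (1 / 2 : ℝ) * (∫⁻ x, f x ^ 2 ∂μ) ^ (1 / 2 : ℝ)) ^ 2 := by gcongr
    _ = μ f.support * ∫⁻ x, f x ^ 2 ∂μ := by rw [mul_pow, hsq, hsq]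

theorem sq_enorm_integral_le_measure_mul [IsProbabilityMeasure μ] {h : X → ℝ} (hm : Measurable h)
    (hh : MemLp h 2 μ) {S : Set X} (hS : h.support ⊆ S) :
    ‖μ[h]‖ₑ ^ 2 ≤ μ S * (eVar[h; μ] + ‖μ[h]‖ₑ ^ 2) := by
  have hmoment : ∫⁻ x, ‖h x‖ₑ ^ 2 ∂μ = eVar[h; μ] + ‖μ[h]‖ₑ ^ 2 := by
    simpa only [sub_zero] using lintegral_enorm_sub_sq hh 0
  have hsupport : (fun x => ‖h x‖ₑ).support ⊆ S := fun x hx => hS (enorm_ne_zero.1 hx)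
  calc ‖μ[h]‖ₑ ^ 2 ≤ (∫⁻ x, ‖h x‖ₑ ∂μ) ^ 2 := by
        gcongr
        exact enorm_integral_le_lintegral_enorm _
    _ ≤ μ (fun x => ‖h x‖ₑ).support * ∫⁻ x, ‖h x‖ₑ ^ 2 ∂μ :=
        sq_lintegral_le_measure_support_mul hm.enorm
    _ ≤ μ S * (eVar[h; μ] + ‖μ[h]‖ₑ ^ 2) := by
        rw [hmoment]
        gcongr

theorem evariance_integral_le [IsProbabilityMeasure ν] [IsProbabilityMeasure τ] {p : E × Y → ℝ}
    (hp : IsBoundedMeasurable p) :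
    eVar[fun y => ∫ e, p (e, y) ∂τ; ν] ≤ ∫⁻ e, eVar[fun y => p (e, y); ν] ∂τ := by
  have hmean : ∫ y, ∫ e, p (e, y) ∂τ ∂ν = ∫ e, ∫ y, p (e, y) ∂ν ∂τ :=
    (integral_integral_swap (f := fun e y => p (e, y)) (hp.integrable _)).symm
  have hdiff : Measurable fun z : E × Y => p z - ∫ y, p (z.1, y) ∂ν :=
    hp.measurable.sub (hp.integral_snd.measurable.comp measurable_fst)
  have hjensen y : ‖∫ e, p (e, y) ∂τ - ∫ e, ∫ y, p (e, y) ∂ν ∂τ‖ₑ ^ 2 ≤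
      ∫⁻ e, ‖p (e, y) - ∫ y, p (e, y) ∂ν‖ₑ ^ 2 ∂τ := by
    rw [← integral_sub ((hp.comp measurable_prodMk_right).integrable τ)
      (hp.integral_snd.integrable τ)]
    calc _ ≤ (∫⁻ e, ‖p (e, y) - ∫ y, p (e, y) ∂ν‖ₑ ∂τ) ^ 2 := by
          gcongr; exact enorm_integral_le_lintegral_enorm _
      _ ≤ _ := sq_lintegral_le_measure_support_mul (hdiff.comp measurable_prodMk_right).enorm
      _ ≤ _ := mul_le_of_le_one_left' prob_le_one
  rw [evariance, hmean]
  refine (lintegral_mono hjensen).trans_eq ?_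
  exact (lintegral_lintegral_swap (hdiff.enorm.pow_const 2).aemeasurable).symm

theorem evariance_indicator_one [IsProbabilityMeasure μ] {A : Set X} (hA : MeasurableSet A) :
    eVar[A.indicator 1; μ] = μ A * (1 - μ A) := by
  have hmean : ‖∫ x, A.indicator (1 : X → ℝ) x ∂μ‖ₑ = μ A := by
    rw [integral_indicator_one hA, Real.enorm_of_nonneg measureReal_nonneg, ofReal_measureReal]
  have hsq x : ‖A.indicator (1 : X → ℝ) x‖ₑ ^ 2 = A.indicator 1 x := by
    by_cases hx : x ∈ A <;> simp [hx]
  have hadd := lintegral_enorm_sub_sq ((IsBoundedMeasurable.indicator_one hA).memLp μ 2) 0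
  simp only [sub_zero, hmean, hsq, lintegral_indicator_one hA] at hadd
  rw [ENNReal.mul_sub fun _ _ => measure_ne_top μ A, mul_one, ← sq]
  exact ENNReal.eq_sub_of_add_eq (ENNReal.pow_ne_top (measure_ne_top μ A)) hadd.symm

end Variance

section Average

variable {X Y E E' : Type*} [MeasurableSpace X] [MeasurableSpace Y] [MeasurableSpace E]
  [MeasurableSpace E'] {μ : Measure X} {ν : Measure Y} {τ : Measure E} {τ' : Measure E'}
  [IsProbabilityMeasure μ] [IsProbabilityMeasure ν] [IsProbabilityMeasure τ]
  [IsProbabilityMeasure τ'] {R : E → X → X} {S : E' → Y → Y}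

theorem integral_integral_comp (hR : Measurable R.uncurry) (hRμ : ∀ e, MeasurePreserving (R e) μ μ)
    {h : X → ℝ} (hh : IsBoundedMeasurable h) :
    ∫ x, ∫ e, h (R e x) ∂τ ∂μ = ∫ x, h x ∂μ := by
  have hinv e : ∫ x, h (R e x) ∂μ = ∫ x, h x ∂μ := by
    rw [← integral_map (hRμ e).aemeasurable hh.measurable.aestronglyMeasurable, (hRμ e).map_eq]
  rw [integral_integral_swap (f := fun x e => h (R e x))
    ((hh.comp (by fun_prop)).integrable _)]
  simp only [hinv, integral_const, probReal_univ, one_smul]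

theorem lintegral_lintegral_comp (hR : Measurable R.uncurry)
    (hRμ : ∀ e, MeasurePreserving (R e) μ μ) {f : X → ℝ≥0∞} (hf : Measurable f) :
    ∫⁻ x, ∫⁻ e, f (R e x) ∂τ ∂μ = ∫⁻ x, f x ∂μ := by
  rw [lintegral_lintegral_swap (f := fun x e => f (R e x))
    (hf.comp (by fun_prop)).aemeasurable]
  simp only [fun e => (hRμ e).lintegral_comp hf, lintegral_const, measure_univ, mul_one]

theorem evariance_average_prod_le (hS : Measurable S.uncurry)
    (hSν : ∀ e, MeasurePreserving (S e) ν ν) (hR : Measurable R.uncurry)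
    (hRμ : ∀ e, MeasurePreserving (R e) μ μ) {h : Y × X → ℝ} (hh : IsBoundedMeasurable h) :
    eVar[fun z => ∫ e, h (S e.1 z.1, R e.2 z.2) ∂τ'.prod τ; ν.prod μ] ≤
      ∫⁻ x, eVar[fun y => ∫ e, h (S e y, x) ∂τ'; ν] ∂μ +
        eVar[fun x => ∫ e, ∫ y, h (y, R e x) ∂ν ∂τ; μ] := by
  have hP : IsBoundedMeasurable fun z : X × Y => ∫ e, h (S e z.2, z.1) ∂τ' :=
    IsBoundedMeasurable.integral_snd (h := fun w : (X × Y) × E' => h (S w.2 w.1.2, w.1.1)) <|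
      hh.comp (by fun_prop)
  have hPR x : IsBoundedMeasurable fun z : E × Y => ∫ e, h (S e z.2, R z.1 x) ∂τ' :=
    hP.comp (f := fun z : E × Y => (R z.1 x, z.2)) (by fun_prop)
  have havg : IsBoundedMeasurable fun z : Y × X => ∫ e, ∫ e', h (S e' z.1, R e z.2) ∂τ' ∂τ :=
    IsBoundedMeasurable.integral_snd
        (h := fun w : (Y × X) × E => ∫ e', h (S e' w.1.1, R w.2 w.1.2) ∂τ') <|
      hP.comp (f := fun w : (Y × X) × E => (R w.2 w.1.2, w.1.1)) (by fun_prop)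
  have hsplit z : ∫ e, h (S e.1 (Prod.fst z), R e.2 (Prod.snd z)) ∂τ'.prod τ =
      ∫ e, ∫ e', h (S e' z.1, R e z.2) ∂τ' ∂τ :=
    integral_prod_symm (fun e : E' × E => h (S e.1 z.1, R e.2 z.2)) <|
      (hh.comp (by fun_prop)).integrable _
  have hmean x : ∫ y, ∫ e, ∫ e', h (S e' y, R e x) ∂τ' ∂τ ∂ν =
      ∫ e, ∫ y, h (y, R e x) ∂ν ∂τ := by
    rw [← integral_integral_swap (f := fun e y => ∫ e', h (S e' y, R e x) ∂τ')
      ((hPR x).integrable _)]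
    simp only [fun e => integral_integral_comp hS hSν (τ := τ')
      (hh.comp (measurable_prodMk_right (y := R e x)))]
  have hconvex x : eVar[fun y => ∫ e, ∫ e', h (S e' y, R e x) ∂τ' ∂τ; ν] ≤
      ∫⁻ e, eVar[fun y => ∫ e', h (S e' y, R e x) ∂τ'; ν] ∂τ :=
    evariance_integral_le (p := fun z : E × Y => ∫ e', h (S e' z.2, R z.1 x) ∂τ') (hPR x)
  have hvar : Measurable fun x => eVar[fun y => ∫ e, h (S e y, x) ∂τ'; ν] :=
    measurable_evariance_snd (h := fun z : X × Y => ∫ e, h (S e z.2, z.1) ∂τ') hP.measurable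
  simp only [hsplit]
  rw [evariance_prod havg]
  simp only [hmean]
  gcongr ?_ + _
  calc ∫⁻ x, eVar[fun y => ∫ e, ∫ e', h (S e' y, R e x) ∂τ' ∂τ; ν] ∂μ
      ≤ ∫⁻ x, ∫⁻ e, eVar[fun y => ∫ e', h (S e' y, R e x) ∂τ'; ν] ∂τ ∂μ := lintegral_mono hconvex
    _ = ∫⁻ x, eVar[fun y => ∫ e', h (S e' y, x) ∂τ'; ν] ∂μ := lintegral_lintegral_comp hR hRμ hvar

end Average

theorem evariance_comp_measurableEquiv {X Y : Type*} [MeasurableSpace X] [MeasurableSpace Y]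
    {μ : Measure X} {ν : Measure Y} {f : Y ≃ᵐ X} (hf : MeasurePreserving f ν μ) (h : X → ℝ) :
    eVar[fun y => h (f y); ν] = eVar[h; μ] := by
  rw [evariance, evariance, hf.integral_comp',
    ← hf.lintegral_comp_emb f.measurableEmbedding fun x => ‖h x - μ[h]‖ₑ ^ 2]

/-- The averaging operators `h ↦ ∫ e, h (R θ e ·) ∂τ` of the measure-preserving maps `R θ e`
contract the variance by the factor `c`, in the mean over `θ`. -/
structure HasAveragingGap {Θ E X : Type*} [MeasurableSpace Θ] [MeasurableSpace E]
    [MeasurableSpace X] (ν : Measure Θ) (τ : Measure E) (μ : Measure X) (R : Θ → E → X → X)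
    (c : ℝ≥0∞) : Prop where
  measurable : Measurable fun p : Θ × E × X => R p.1 p.2.1 p.2.2
  preserving : ∀ θ e, MeasurePreserving (R θ e) μ μ
  gap : ∀ h : X → ℝ, IsBoundedMeasurable h →
    ∫⁻ θ, eVar[fun x => ∫ e, h (R θ e x) ∂τ; μ] ∂ν ≤ c * eVar[h; μ]

namespace HasAveragingGap

variable {Θ E E' X Y : Type*} [MeasurableSpace Θ] [MeasurableSpace E] [MeasurableSpace E']
  [MeasurableSpace X] [MeasurableSpace Y] {ν : Measure Θ} {τ : Measure E} {τ' : Measure E'}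
  {μ : Measure X} {μ' : Measure Y} {R : Θ → E → X → X} {S : Θ → E' → Y → Y} {c : ℝ≥0∞}

theorem measurable_apply {Z : Type*} [MeasurableSpace Z] (hR : HasAveragingGap ν τ μ R c)
    {θ : Z → Θ} {e : Z → E} {x : Z → X} (hθ : Measurable θ) (he : Measurable e)
    (hx : Measurable x) : Measurable fun z => R (θ z) (e z) (x z) :=
  hR.measurable.comp (hθ.prodMk (he.prodMk hx))

theorem measurable_uncurry (hR : HasAveragingGap ν τ μ R c) (θ : Θ) : Measurable (R θ).uncurry :=
  hR.measurable_apply measurable_const measurable_fst measurable_snd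

theorem prod [SFinite ν] [IsProbabilityMeasure τ] [IsProbabilityMeasure τ']
    [IsProbabilityMeasure μ] [IsProbabilityMeasure μ'] (hS : HasAveragingGap ν τ' μ' S c)
    (hR : HasAveragingGap ν τ μ R c) :
    HasAveragingGap ν (τ'.prod τ) (μ'.prod μ)
      (fun θ (e : E' × E) (z : Y × X) => (S θ e.1 z.1, R θ e.2 z.2)) c where
  measurable :=
    (hS.measurable_apply (by fun_prop) (by fun_prop) (by fun_prop)).prodMk
      (hR.measurable_apply (by fun_prop) (by fun_prop) (by fun_prop))
  preserving θ e := (hS.preserving θ e.1).prod (hR.preserving θ e.2)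
  gap h hh := by
    have hmean : IsBoundedMeasurable fun x => ∫ y, h (y, x) ∂μ' :=
      IsBoundedMeasurable.integral_snd (h := fun z : X × Y => h z.swap) (hh.comp measurable_swap)
    have hS' : Measurable fun w : ((Θ × X) × Y) × E' => S w.1.1.1 w.2 w.1.2 :=
      hS.measurable_apply (by fun_prop) (by fun_prop) (by fun_prop)
    have havg : IsBoundedMeasurable fun z : (Θ × X) × Y => ∫ e, h (S z.1.1 e z.2, z.1.2) ∂τ' :=
      IsBoundedMeasurable.integral_snd
          (h := fun w : ((Θ × X) × Y) × E' => h (S w.1.1.1 w.2 w.1.2, w.1.1.2)) <|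
        hh.comp (hS'.prodMk (by fun_prop))
    have hvar : Measurable fun z : Θ × X => eVar[fun y => ∫ e, h (S z.1 e y, z.2) ∂τ'; μ'] :=
      measurable_evariance_snd
        (h := fun w : (Θ × X) × Y => ∫ e, h (S w.1.1 e w.2, w.1.2) ∂τ') havg.measurable
    calc ∫⁻ θ, eVar[fun z => ∫ e, h (S θ e.1 z.1, R θ e.2 z.2) ∂τ'.prod τ; μ'.prod μ] ∂ν
        ≤ ∫⁻ θ, (∫⁻ x, eVar[fun y => ∫ e, h (S θ e y, x) ∂τ'; μ'] ∂μ +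
            eVar[fun x => ∫ e, ∫ y, h (y, R θ e x) ∂μ' ∂τ; μ]) ∂ν :=
          lintegral_mono fun θ => evariance_average_prod_le (hS.measurable_uncurry θ)
            (hS.preserving θ) (hR.measurable_uncurry θ) (hR.preserving θ) hh
      _ = ∫⁻ x, ∫⁻ θ, eVar[fun y => ∫ e, h (S θ e y, x) ∂τ'; μ'] ∂ν ∂μ +
            ∫⁻ θ, eVar[fun x => ∫ e, ∫ y, h (y, R θ e x) ∂μ' ∂τ; μ] ∂ν := by
          rw [lintegral_add_left hvar.lintegral_prod_right', lintegral_lintegral_swap]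
          exact hvar.aemeasurable
      _ ≤ ∫⁻ x, c * eVar[fun y => h (y, x); μ'] ∂μ +
            c * eVar[fun x => ∫ y, h (y, x) ∂μ'; μ] :=
          add_le_add
            (lintegral_mono fun x => hS.gap (fun y => h (y, x)) (hh.comp measurable_prodMk_right))
            (hR.gap _ hmean)
      _ = c * eVar[h; μ'.prod μ] := by
          rw [lintegral_const_mul _ (measurable_evariance_fst hh.measurable), ← mul_add,
            evariance_prod hh]

theorem of_equiv (hR : HasAveragingGap ν τ μ R c) {f : Y ≃ᵐ X} (hf : MeasurePreserving f μ' μ)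
    {g : E' ≃ᵐ E} (hg : MeasurePreserving g τ' τ) :
    HasAveragingGap ν τ' μ' (fun θ e y => f.symm (R θ (g e) (f y))) c where
  measurable := f.symm.measurable.comp <|
    hR.measurable_apply (by fun_prop) (by fun_prop) (by fun_prop)
  preserving θ e := (hf.symm f).comp ((hR.preserving θ (g e)).comp hf)
  gap h hh := by
    have hreindex θ y : ∫ e, h (f.symm (R θ (g e) (f y))) ∂τ' =
        ∫ e, h (f.symm (R θ e (f y))) ∂τ :=
      hg.integral_comp' fun e => h (f.symm (R θ e (f y)))
    have havg θ : eVar[fun y => ∫ e, h (f.symm (R θ e (f y))) ∂τ; μ'] =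
        eVar[fun x => ∫ e, h (f.symm (R θ e x)) ∂τ; μ] :=
      evariance_comp_measurableEquiv hf fun x => ∫ e, h (f.symm (R θ e x)) ∂τ
    simp only [hreindex, havg]
    rw [← evariance_comp_measurableEquiv (hf.symm f) h]
    exact hR.gap _ (hh.comp f.symm.measurable)

theorem pi [SFinite ν] [IsProbabilityMeasure τ] [IsProbabilityMeasure μ]
    (hR : HasAveragingGap ν τ μ R c) (n : ℕ) :
    HasAveragingGap ν (Measure.pi fun _ : Fin n => τ) (Measure.pi fun _ : Fin n => μ)
      (fun θ e x i => R θ (e i) (x i)) c := by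
  induction n with
  | zero =>
    refine ⟨measurable_pi_lambda _ fun i => i.elim0, fun θ e => ?_, fun h _ => ?_⟩
    · convert MeasurePreserving.id _
    · have hconst (x : Fin 0 → X) : h x = h default := congrArg h (Subsingleton.elim _ _)
      simp [hconst, evariance]
  | succ n ih =>
    convert (hR.prod ih).of_equiv (measurePreserving_piFinSuccAbove (fun _ => μ) 0)
      (measurePreserving_piFinSuccAbove (fun _ => τ) 0) using 1
    ext θ e x i
    cases i using Fin.cases <;> rfl

-- The average of the indicator of `A` vanishes outside `S θ`; Cauchy–Schwarz bounds its second
-- moment from below, the gap bounds it from above.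
theorem measure_sq_le [IsProbabilityMeasure ν] [IsProbabilityMeasure τ] [IsProbabilityMeasure μ]
    (hR : HasAveragingGap ν τ μ R c) {A : Set X} (hA : MeasurableSet A) {S : Θ → Set X}
    (hRS : ∀ θ e x, R θ e x ∈ A → x ∈ S θ) {b : ℝ≥0∞} (hb : ∀ θ, μ (S θ) ≤ b) :
    μ A ^ 2 ≤ b * (c * eVar[A.indicator 1; μ] + μ A ^ 2) := by
  have hind := IsBoundedMeasurable.indicator_one hA
  set q : Θ → X → ℝ := fun θ x => ∫ e, A.indicator 1 (R θ e x) ∂τ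
  have hR' : Measurable fun w : (Θ × X) × E => R w.1.1 w.2 w.1.2 :=
    hR.measurable_apply (by fun_prop) (by fun_prop) (by fun_prop)
  have hq : IsBoundedMeasurable fun z : Θ × X => q z.1 z.2 :=
    IsBoundedMeasurable.integral_snd
      (h := fun w : (Θ × X) × E => A.indicator 1 (R w.1.1 w.2 w.1.2)) (hind.comp hR')
  have hqθ θ : IsBoundedMeasurable (q θ) := hq.comp measurable_prodMk_left
  have hmean θ : ‖∫ x, q θ x ∂μ‖ₑ = μ A := by
    rw [integral_integral_comp (hR.measurable_uncurry θ) (hR.preserving θ) hind,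
      integral_indicator_one hA, Real.enorm_of_nonneg measureReal_nonneg, ofReal_measureReal]
  have hsupport θ : (q θ).support ⊆ S θ := fun x => by
    contrapose!
    intro hx
    have hout e : A.indicator (1 : X → ℝ) (R θ e x) = 0 :=
      Set.indicator_of_notMem (fun he => hx (hRS θ e x he)) _
    simp only [q, hout, integral_zero, Function.notMem_support]
  have hθ θ : μ A ^ 2 ≤ b * (eVar[q θ; μ] + μ A ^ 2) := by
    rw [← hmean θ]
    refine (sq_enorm_integral_le_measure_mul (hqθ θ).measurable ((hqθ θ).memLp μ 2)
      (hsupport θ)).trans ?_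
    gcongr
    exact hb θ
  have hvar : Measurable fun θ => eVar[q θ; μ] := measurable_evariance_snd hq.measurable
  calc μ A ^ 2 = ∫⁻ _, μ A ^ 2 ∂ν := by simp
    _ ≤ ∫⁻ θ, b * (eVar[q θ; μ] + μ A ^ 2) ∂ν := lintegral_mono hθ
    _ = b * (∫⁻ θ, eVar[q θ; μ] ∂ν + μ A ^ 2) := by
        rw [lintegral_const_mul _ (hvar.add_const _), lintegral_add_right _ measurable_const]
        simp
    _ ≤ b * (c * eVar[A.indicator 1; μ] + μ A ^ 2) := by
        gcongr
        exact hR.gap _ hind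

theorem measure_le [IsProbabilityMeasure ν] [IsProbabilityMeasure τ] [IsProbabilityMeasure μ]
    (hR : HasAveragingGap ν τ μ R c) {A : Set X} (hA : MeasurableSet A) {S : Θ → Set X}
    (hRS : ∀ θ e x, R θ e x ∈ A → x ∈ S θ) {b : ℝ≥0∞} (hb : ∀ θ, μ (S θ) ≤ b) :
    μ A ≤ b * (c * (1 - μ A) + μ A) := by
  rcases eq_or_ne (μ A) 0 with h0 | h0
  · exact h0 ▸ zero_le
  · refine (ENNReal.mul_le_mul_iff_right h0 (measure_ne_top μ A)).1 ?_
    calc μ A * μ A ≤ b * (c * (μ A * (1 - μ A)) + μ A ^ 2) := by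
          rw [← sq, ← evariance_indicator_one hA]
          exact hR.measure_sq_le hA hRS hb
      _ = μ A * (b * (c * (1 - μ A) + μ A)) := by ring

end HasAveragingGap

section GeometricGraph

variable {M : Type*} [MetricSpace M] {n : ℕ}

theorem geometricGraph_mono (x : Fin n → M) : Monotone (geometricGraph x) :=
  fun _ _ h _ _ hij => ⟨hij.1, hij.2.trans h⟩

theorem geometricGraph_le_comp {L : NNReal} {T : M → M} (hT : LipschitzWith L T) (x : Fin n → M)
    (r : ℝ) : geometricGraph x r ≤ geometricGraph (fun i => T (x i)) (L * r) :=
  fun _ _ hij => ⟨hij.1, (hT.dist_le_mul _ _).trans (by gcongr; exact hij.2)⟩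

theorem geometricGraph_diam [BoundedSpace M] (x : Fin n → M) :
    geometricGraph x (Metric.diam (Set.univ : Set M)) = ⊤ :=
  eq_top_iff.2 fun _ _ hij => ⟨hij.ne, Metric.dist_le_diam_of_mem (Bornology.IsBounded.all _)
    (Set.mem_univ _) (Set.mem_univ _)⟩

theorem geometricGraph_eq_bot_iff {x : Fin n → M} {r : ℝ} :
    geometricGraph x r = ⊥ ↔ ∀ i j, i ≠ j → r < dist (x i) (x j) := by
  simp only [eq_bot_iff, SimpleGraph.le_iff_adj, SimpleGraph.bot_adj, geometricGraph, not_and,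
    not_le, imp_false]

theorem isOpen_setOf_geometricGraph_eq_bot (r : ℝ) :
    IsOpen {x : Fin n → M | geometricGraph x r = ⊥} := by
  simp only [geometricGraph_eq_bot_iff, Set.ofPred_forall]
  exact isOpen_iInter_of_finite fun i => isOpen_iInter_of_finite fun j =>
    isOpen_iInter_of_finite fun _ => isOpen_lt continuous_const (by fun_prop)

theorem exists_pos_geometricGraph_eq_bot [Infinite M] (n : ℕ) :
    ∃ r > 0, ∃ x : Fin n → M, geometricGraph x r = ⊥ := by
  let x : Fin n ↪ M := Fin.valEmbedding.trans (Infinite.natEmbedding M)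
  have hsep : ∀ᶠ r in 𝓝[>] (0 : ℝ), ∀ i j, i ≠ j → r < dist (x i) (x j) := by
    simp only [eventually_all]
    exact fun i j hij =>
      nhdsWithin_le_nhds (eventually_lt_nhds (dist_pos.2 (x.injective.ne hij)))
  obtain ⟨r, hr, hpos⟩ := (hsep.and self_mem_nhdsWithin).exists
  exact ⟨r, hpos, x, geometricGraph_eq_bot_iff.2 hr⟩

theorem measurableSet_geometricGraph_mem [MeasurableSpace M] [BorelSpace M]
    [SecondCountableTopology M] (F : Set (SimpleGraph (Fin n))) (r : ℝ) :
    MeasurableSet {x : Fin n → M | geometricGraph x r ∈ F} := by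
  have hadj i j : MeasurableSet {x : Fin n → M | (geometricGraph x r).Adj i j} :=
    (MeasurableSet.const (i ≠ j)).inter <|
      measurableSet_le (f := fun x : Fin n → M => dist (x i) (x j)) (by fun_prop) measurable_const
  have hfiber (G : SimpleGraph (Fin n)) :
      MeasurableSet {x : Fin n → M | geometricGraph x r = G} := by
    simp only [SimpleGraph.ext_iff, funext_iff, eq_iff_iff, Set.ofPred_forall]
    exact .iInter fun i => .iInter fun j => (hadj i j).iff (.const _)
  have hunion : {x : Fin n → M | geometricGraph x r ∈ F} =
      ⋃ G ∈ F, {x | geometricGraph x r = G} := by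
    ext x
    simp
  rw [hunion]
  exact .biUnion F.to_countable fun G _ => hfiber G

end GeometricGraph

namespace IsNontrivialMonotone

variable {n : ℕ} {F : Set (SimpleGraph (Fin n))}

theorem top_mem (hF : IsNontrivialMonotone F) : ⊤ ∈ F :=
  have ⟨_, hG⟩ := Set.nonempty_iff_ne_empty.2 hF.ne_empty
  hF.monotone le_top hG

theorem bot_notMem (hF : IsNontrivialMonotone F) : ⊥ ∉ F := fun h =>
  hF.ne_univ (Set.eq_univ_of_forall fun _ => hF.monotone bot_le h)

end IsNontrivialMonotone

section GeometricProb

variable {M : Type*} [MetricSpace M] [MeasurableSpace M] {μ : Measure M} [IsProbabilityMeasure μ]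
  {n : ℕ} {F : Set (SimpleGraph (Fin n))}

theorem geometricProb_le_one (r : ℝ) : geometricProb μ F r ≤ 1 :=
  prob_le_one

theorem geometricProb_mono (hF : IsUpperSet F) : Monotone (geometricProb μ F) := fun _ _ hrs =>
  measure_mono fun x hx => hF (geometricGraph_mono x hrs) hx

theorem geometricProb_diam [BoundedSpace M] (hF : IsNontrivialMonotone F) :
    geometricProb μ F (Metric.diam (Set.univ : Set M)) = 1 := by
  simp only [geometricProb, geometricGraph_diam, hF.top_mem, Set.ofPred_true, measure_univ]

theorem exists_pos_geometricProb_lt_one [BorelSpace M] [SecondCountableTopology M] [Infinite M]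
    [μ.IsOpenPosMeasure] (hF : IsNontrivialMonotone F) : ∃ r > 0, geometricProb μ F r < 1 := by
  obtain ⟨r, hr, x, hx⟩ := exists_pos_geometricGraph_eq_bot (M := M) n
  have hopen := isOpen_setOf_geometricGraph_eq_bot (M := M) (n := n) r
  refine ⟨r, hr, ?_⟩
  calc geometricProb μ F r
      ≤ Measure.pi (fun _ => μ) {x : Fin n → M | geometricGraph x r = ⊥}ᶜ :=
        measure_mono fun y hy hbot => hF.bot_notMem (hbot ▸ hy)
    _ = 1 - Measure.pi (fun _ => μ) {x : Fin n → M | geometricGraph x r = ⊥} :=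
        prob_compl_eq_one_sub hopen.measurableSet
    _ < 1 := ENNReal.sub_lt_self ENNReal.one_ne_top one_ne_zero (hopen.measure_pos _ ⟨x, hx⟩).ne'

end GeometricProb

section Odds

variable {p q c : ℝ≥0∞}

/-- The odds of an event of probability `p`, with value `∞` at `p = 1`. -/
noncomputable def odds (p : ℝ≥0∞) : ℝ≥0∞ := p / (1 - p)

theorem odds_mono : Monotone odds := fun _ _ hpq =>
  ENNReal.div_le_div hpq (tsub_le_tsub_left hpq 1)

theorem odds_one : odds 1 = ∞ := by simp [odds]

theorem odds_ne_top (hp : p < 1) : odds p ≠ ∞ :=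
  ENNReal.div_ne_top hp.ne_top (tsub_pos_of_lt hp).ne'

theorem le_odds (p : ℝ≥0∞) : p ≤ odds p := by
  calc p = p / 1 := (div_one p).symm
    _ ≤ p / (1 - p) := ENNReal.div_le_div_left tsub_le_self p

theorem one_sub_le_inv_odds (hp : p ≤ 1) : 1 - p ≤ (odds p)⁻¹ := by
  have hpos : 1 - p ≠ 0 ∨ p ≠ 0 := by
    rcases eq_or_ne p 0 with rfl | h
    · simp
    · exact .inr h
  calc 1 - p = (1 - p) / 1 := (div_one _).symm
    _ ≤ (1 - p) / p := ENNReal.div_le_div_left hp _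
    _ = (odds p)⁻¹ := (ENNReal.inv_div (.inl (by finiteness)) hpos).symm

theorem odds_le_mul_odds (hc : c ≠ 0) (hp : p ≤ 1) (hq : q ≤ 1)
    (h : p ≤ q * (c * (1 - p) + p)) : odds p ≤ c * odds q := by
  rcases hq.eq_or_lt with rfl | hq
  · simp [odds_one, hc]
  have hp' : p < 1 := by
    refine hp.lt_of_ne ?_
    rintro rfl
    exact hq.not_ge (by simpa using h)
  have hcross : p * (1 - q) ≤ c * q * (1 - p) := by
    rw [ENNReal.mul_sub fun _ _ => hp'.ne_top, mul_one, tsub_le_iff_right]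
    exact h.trans_eq (by ring)
  rw [odds, odds, ← mul_div_assoc, ENNReal.div_le_iff (tsub_pos_of_lt hp').ne' (by finiteness),
    mul_comm, ← mul_div_assoc, ENNReal.le_div_iff_mul_le (.inl (tsub_pos_of_lt hq).ne')
    (.inl (by finiteness)), mul_comm (1 - p)]
  exact hcross

end Odds

section Scaling

variable {c : ℝ≥0∞} {L : ℝ}

theorem le_pow_mul_of_scaling {f : ℝ → ℝ≥0∞} (hf : ∀ r, f r ≤ c * f (L * r)) (m : ℕ) (r : ℝ) :
    f r ≤ c ^ m * f (L ^ m * r) := by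
  induction m with
  | zero => simp
  | succ m ih =>
    calc f r ≤ c ^ m * f (L ^ m * r) := ih
      _ ≤ c ^ m * (c * f (L * (L ^ m * r))) := by gcongr; exact hf _
      _ = c ^ (m + 1) * f (L ^ (m + 1) * r) := by rw [pow_succ, mul_assoc, pow_succ', mul_assoc]

theorem exists_pos_crossing {f : ℝ → ℝ≥0∞} (hmono : Monotone f) (hc : c < 1) (hL : 0 < L)
    (hf : ∀ r, f r ≤ c * f (L * r)) (hsmall : ∃ r > 0, f r ≠ ∞) (hlarge : ∃ r, 1 < f r) :
    ∃ ρ > 0, (∀ r < ρ, f r ≤ 1) ∧ ∀ r > ρ, 1 < f r := by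
  obtain ⟨η, hη, hfη⟩ := hsmall
  obtain ⟨r, hr⟩ := hlarge
  have hlim : Tendsto (fun m => c ^ m * f η) atTop (𝓝 0) := by
    simpa using ENNReal.Tendsto.mul_const (ENNReal.tendsto_pow_atTop_nhds_zero_of_lt_one hc)
      (.inr hfη)
  obtain ⟨m, hm⟩ := (hlim.eventually_lt_const one_pos).exists
  have hmem : f (η / L ^ m) ≤ 1 := by
    have hscale := le_pow_mul_of_scaling hf m (η / L ^ m)
    rw [mul_div_cancel₀ _ (pow_pos hL m).ne'] at hscale
    exact hscale.trans hm.le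
  have hbdd : BddAbove {s | f s ≤ 1} :=
    ⟨r, fun s hs => (hmono.reflect_lt ((show f s ≤ 1 from hs).trans_lt hr)).le⟩
  refine ⟨sSup {s | f s ≤ 1}, (div_pos hη (pow_pos hL m)).trans_le (le_csSup hbdd hmem),
    fun s hs => ?_, fun s hs => ?_⟩
  · obtain ⟨t, ht, hst⟩ := exists_lt_of_lt_csSup ⟨η / L ^ m, hmem⟩ hs
    exact (hmono hst.le).trans ht
  · by_contra! hle
    exact hs.not_ge (le_csSup hbdd hle)

theorem tendsto_zero_of_eventually_le_pow {ι : Type*} {l : Filter ι} {u : ι → ℝ≥0∞} (hc : c < 1)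
    (hu : ∀ m : ℕ, ∀ᶠ i in l, u i ≤ c ^ m) : Tendsto u l (𝓝 0) := by
  refine ENNReal.tendsto_nhds_zero.2 fun ε hε => ?_
  obtain ⟨m, hm⟩ := ((ENNReal.tendsto_pow_atTop_nhds_zero_of_lt_one hc).eventually_lt_const
    hε).exists
  exact (hu m).mono fun i hi => hi.trans hm.le

variable {ι : Type*} {l : Filter ι} {f : ι → ℝ → ℝ≥0∞} {ρ s : ι → ℝ}

theorem tendsto_zero_of_scaling (hc : c < 1) (hL : 0 < L) (hρ : ∀ i, 0 < ρ i)
    (hf : ∀ᶠ i in l, ∀ r, f i r ≤ c * f i (L * r)) (hle : ∀ᶠ i in l, ∀ r < ρ i, f i r ≤ 1)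
    (hs : Tendsto (fun i => s i / ρ i) l (𝓝 0)) : Tendsto (fun i => f i (s i)) l (𝓝 0) := by
  refine tendsto_zero_of_eventually_le_pow hc fun m => ?_
  filter_upwards [hf, hle, hs.eventually_lt_const (inv_pos.2 (pow_pos hL m))] with i hf hle hlt
  have hbelow : L ^ m * s i < ρ i := by
    rwa [div_lt_iff₀ (hρ i), inv_mul_eq_div, lt_div_iff₀' (pow_pos hL m)] at hlt
  exact (le_pow_mul_of_scaling hf m (s i)).trans (mul_le_of_le_one_right' (hle _ hbelow))

theorem tendsto_inv_zero_of_scaling (hc : c < 1) (hL : 0 < L) (hρ : ∀ i, 0 < ρ i)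
    (hf : ∀ᶠ i in l, ∀ r, f i r ≤ c * f i (L * r)) (hlt : ∀ᶠ i in l, ∀ r > ρ i, 1 < f i r)
    (hs : Tendsto (fun i => s i / ρ i) l atTop) : Tendsto (fun i => (f i (s i))⁻¹) l (𝓝 0) := by
  refine tendsto_zero_of_eventually_le_pow hc fun m => ?_
  filter_upwards [hf, hlt, hs.eventually_gt_atTop (L ^ m)] with i hf hlt hgt
  have habove : ρ i < s i / L ^ m := by
    rwa [lt_div_iff₀ (hρ i), ← lt_div_iff₀' (pow_pos hL m)] at hgt
  have hscale := le_pow_mul_of_scaling hf m (s i / L ^ m)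
  rw [mul_div_cancel₀ _ (pow_pos hL m).ne'] at hscale
  have hlt := (hlt _ habove).trans_le hscale
  rw [mul_comm] at hlt
  have hne := (one_pos.trans hlt).ne'
  exact (ENNReal.inv_le_iff_le_mul (fun _ => left_ne_zero_of_mul hne)
    fun _ => right_ne_zero_of_mul hne).2 hlt.le

end Scaling

theorem admitsThresholds_of_odds_le {M : Type*} [MetricSpace M] [MeasurableSpace M]
    {μ : Measure M} [IsProbabilityMeasure μ] [BorelSpace M] [SecondCountableTopology M]
    [BoundedSpace M] [Infinite M] [μ.IsOpenPosMeasure] {c : ℝ≥0∞} (hc : c < 1) {L : ℝ} (hL : 0 < L)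
    (hodds : ∀ {n : ℕ} {F : Set (SimpleGraph (Fin n))}, IsUpperSet F → ∀ r,
      odds (geometricProb μ F r) ≤ c * odds (geometricProb μ F (L * r))) :
    AdmitsThresholds M μ := by
  intro F hF
  have hcrossing n : ∃ ρ > 0, 2 ≤ n → (∀ r < ρ, odds (geometricProb μ (F n) r) ≤ 1) ∧
      ∀ r > ρ, 1 < odds (geometricProb μ (F n) r) := by
    by_cases hn : 2 ≤ n
    · obtain ⟨η, hη, hlt⟩ := exists_pos_geometricProb_lt_one (μ := μ) (hF n hn)
      have hdiam : 1 < odds (geometricProb μ (F n) (Metric.diam (Set.univ : Set M))) := by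
        rw [geometricProb_diam (hF n hn), odds_one]
        exact ENNReal.one_lt_top
      obtain ⟨ρ, hρ, h⟩ := exists_pos_crossing
        (odds_mono.comp (geometricProb_mono (μ := μ) (hF n hn).monotone)) hc hL
        (hodds (hF n hn).monotone) ⟨η, hη, odds_ne_top hlt⟩ ⟨_, hdiam⟩
      exact ⟨ρ, hρ, fun _ => h⟩
    · exact ⟨1, one_pos, fun h => absurd h hn⟩
  choose ρ hρ hcrossing using hcrossing
  have hscale : ∀ᶠ n in atTop, ∀ r,
      odds (geometricProb μ (F n) r) ≤ c * odds (geometricProb μ (F n) (L * r)) :=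
    (eventually_ge_atTop 2).mono fun n hn => hodds (hF n hn).monotone
  have hcrossing := (eventually_ge_atTop 2).mono hcrossing
  refine ⟨ρ, hρ, fun s _ hs => ?_, fun s _ hs => ?_⟩
  · exact tendsto_of_tendsto_of_tendsto_of_le_of_le tendsto_const_nhds
      (tendsto_zero_of_scaling hc hL hρ hscale (hcrossing.mono fun _ h => h.1) hs)
      (fun _ => zero_le) fun _ => le_odds _
  · have hcompl : Tendsto (fun n => 1 - geometricProb μ (F n) (s n)) atTop (𝓝 0) :=
      tendsto_of_tendsto_of_tendsto_of_le_of_le tendsto_const_nhds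
        (tendsto_inv_zero_of_scaling hc hL hρ hscale (hcrossing.mono fun _ h => h.2) hs)
        (fun _ => zero_le) fun _ => one_sub_le_inv_odds (geometricProb_le_one _)
    simpa only [ENNReal.sub_sub_cancel ENNReal.one_ne_top (geometricProb_le_one _), tsub_zero]
      using ENNReal.Tendsto.sub tendsto_const_nhds hcompl (.inl ENNReal.one_ne_top)

/-- A random fold: the maps `T θ` preserve the measure, expand distances at most by the factor `L`,
and are constant along the averaging maps `R θ e`, which have averaging gap `c`. -/
structure IsRandomFold {Θ E M : Type*} [MeasurableSpace Θ] [MeasurableSpace E] [MeasurableSpace M]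
    [PseudoEMetricSpace M] (ν : Measure Θ) (τ : Measure E) (μ : Measure M) (R : Θ → E → M → M)
    (T : Θ → M → M) (c : ℝ≥0∞) (L : NNReal) : Prop extends HasAveragingGap ν τ μ R c where
  fold_preserving : ∀ θ, MeasurePreserving (T θ) μ μ
  lipschitzWith : ∀ θ, LipschitzWith L (T θ)
  fold_apply : ∀ θ e x, T θ (R θ e x) = T θ x

namespace IsRandomFold

variable {Θ E M : Type*} [MeasurableSpace Θ] [MeasurableSpace E] [MetricSpace M]
  [MeasurableSpace M] [BorelSpace M] [SecondCountableTopology M] {ν : Measure Θ} {τ : Measure E}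
  {μ : Measure M} [IsProbabilityMeasure ν] [IsProbabilityMeasure τ] [IsProbabilityMeasure μ]
  {R : Θ → E → M → M} {T : Θ → M → M} {c : ℝ≥0∞} {L : NNReal}

theorem odds_geometricProb_le (hT : IsRandomFold ν τ μ R T c L) (hc : c ≠ 0) {n : ℕ}
    {F : Set (SimpleGraph (Fin n))} (hF : IsUpperSet F) (r : ℝ) :
    odds (geometricProb μ F r) ≤ c * odds (geometricProb μ F (L * r)) := by
  have hmeas s := measurableSet_geometricGraph_mem (M := M) F s
  have hpi θ : MeasurePreserving (fun (x : Fin n → M) i => T θ (x i)) (Measure.pi fun _ => μ)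
      (Measure.pi fun _ => μ) := measurePreserving_pi _ _ fun _ => hT.fold_preserving θ
  have hprob θ : Measure.pi (fun _ => μ)
      {x : Fin n → M | geometricGraph (fun i => T θ (x i)) (L * r) ∈ F} =
      geometricProb μ F (L * r) :=
    (hpi θ).measure_preimage (hmeas _).nullMeasurableSet
  refine odds_le_mul_odds hc (geometricProb_le_one r) (geometricProb_le_one _) <|
    (hT.pi n).measure_le (hmeas r) (fun θ e x hx => ?_) fun θ => (hprob θ).le
  have hfold := hF (geometricGraph_le_comp (hT.lipschitzWith θ) _ r) hx
  simp only [hT.fold_apply] at hfold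
  exact hfold

theorem admitsThresholds [BoundedSpace M] [Infinite M] [μ.IsOpenPosMeasure]
    (hT : IsRandomFold ν τ μ R T c L) (hc0 : c ≠ 0) (hc1 : c < 1) (hL : 0 < L) :
    AdmitsThresholds M μ :=
  admitsThresholds_of_odds_le hc1 (NNReal.coe_pos.2 hL) fun hF => hT.odds_geometricProb_le hc0 hF

end IsRandomFold

section Reflection

/-- The uniform probability measure on `Bool`, which selects the coordinates to be reflected. -/
noncomputable def fairCoin : Measure Bool := (PMF.uniformOfFintype Bool).toMeasure

instance fairCoin.isProbabilityMeasure : IsProbabilityMeasure fairCoin :=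
  PMF.toMeasure.isProbabilityMeasure _

theorem integral_fairCoin (f : Bool → ℝ) : ∫ e, f e ∂fairCoin = (f true + f false) / 2 := by
  rw [fairCoin, PMF.integral_eq_sum, Fintype.sum_bool]
  simp only [PMF.uniformOfFintype_apply, Fintype.card_bool, Nat.cast_ofNat, ENNReal.toReal_inv,
    ENNReal.toReal_ofNat, smul_eq_mul]
  ring

variable {G : Type*} [AddCommGroup G]

/-- The point reflection at `θ` if `e` is `true`, and the identity if `e` is `false`. -/
def reflection (θ : G) (e : Bool) (x : G) : G := if e then (2 : ℤ) • θ - x else x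

theorem integral_reflection (h : G → ℝ) (θ x : G) :
    ∫ e, h (reflection θ e x) ∂fairCoin = (h ((2 : ℤ) • θ - x) + h x) / 2 :=
  integral_fairCoin _

theorem enorm_integral_reflection_sub_sq (h : G → ℝ) (m : ℝ) (θ x : G) :
    ‖∫ e, h (reflection θ e x) ∂fairCoin - m‖ₑ ^ 2 =
      4⁻¹ * ‖h ((2 : ℤ) • θ - x) - (2 * m - h x)‖ₑ ^ 2 := by
  have hhalf : (h ((2 : ℤ) • θ - x) + h x) / 2 - m =
      2⁻¹ * (h ((2 : ℤ) • θ - x) - (2 * m - h x)) := by ring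
  have hfour : ‖(2⁻¹ : ℝ)‖ₑ ^ 2 = 4⁻¹ := by
    rw [enorm_inv two_ne_zero, Real.enorm_of_nonneg zero_le_two, ENNReal.ofReal_ofNat,
      ← ENNReal.inv_pow]
    norm_num
  rw [integral_reflection, hhalf, enorm_mul, mul_pow, hfour]

variable [TopologicalSpace G] [IsTopologicalAddGroup G] [MeasurableSpace G] [BorelSpace G]

theorem measurable_reflection [SecondCountableTopology G] :
    Measurable fun p : G × Bool × G => reflection p.1 p.2.1 p.2.2 :=
  .ite ((measurable_fst.comp measurable_snd) (measurableSet_singleton true)) (by fun_prop)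
    (by fun_prop)

variable [CompactSpace G] (μ : Measure G) [μ.IsAddHaarMeasure]

theorem measurePreserving_reflection (θ : G) (e : Bool) :
    MeasurePreserving (reflection θ e) μ μ := by
  cases e
  · exact MeasurePreserving.id μ
  · exact μ.measurePreserving_sub_left _

variable [SecondCountableTopology G] [DivisibleBy G ℤ] [IsProbabilityMeasure μ]

-- For fixed `x`, the point `2θ - x` is uniform when `θ` is, so that `h x` gets averaged with an
-- independent copy of itself.
theorem lintegral_evariance_reflection {h : G → ℝ} (hh : IsBoundedMeasurable h) :
    ∫⁻ θ, eVar[fun x => ∫ e, h (reflection θ e x) ∂fairCoin; μ] ∂μ = 2⁻¹ * eVar[h; μ] := by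
  have hdouble x : MeasurePreserving (fun θ : G => (2 : ℤ) • θ - x) μ μ :=
    (measurePreserving_sub_right μ x).comp (Measure.measurePreserving_zsmul μ two_ne_zero)
  have hmean θ : ∫ x, ∫ e, h (reflection θ e x) ∂fairCoin ∂μ = μ[h] :=
    integral_integral_comp (R := reflection θ) (measurable_reflection.comp measurable_prodMk_left)
      (measurePreserving_reflection μ θ) hh
  have hsq y : Measurable fun x => ‖h x - y‖ₑ ^ 2 := (hh.measurable.sub_const y).enorm.pow_const 2
  have hinner x : ∫⁻ θ, ‖h ((2 : ℤ) • θ - x) - (2 * μ[h] - h x)‖ₑ ^ 2 ∂μ =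
      eVar[h; μ] + ‖h x - μ[h]‖ₑ ^ 2 := by
    rw [(hdouble x).lintegral_comp (hsq (2 * μ[h] - h x)), lintegral_enorm_sub_sq (hh.memLp μ 2),
      sub_sub_eq_add_sub, two_mul, add_sub_add_left_eq_sub]
  have hmeas : Measurable fun p : G × G => ‖h ((2 : ℤ) • p.1 - p.2) - (2 * μ[h] - h p.2)‖ₑ ^ 2 :=
    have hreflect : Measurable fun p : G × G => h ((2 : ℤ) • p.1 - p.2) :=
      hh.measurable.comp (by fun_prop)
    (hreflect.sub ((hh.measurable.comp measurable_snd).const_sub _)).enorm.pow_const 2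
  calc ∫⁻ θ, eVar[fun x => ∫ e, h (reflection θ e x) ∂fairCoin; μ] ∂μ
      = 4⁻¹ * ∫⁻ θ, ∫⁻ x, ‖h ((2 : ℤ) • θ - x) - (2 * μ[h] - h x)‖ₑ ^ 2 ∂μ ∂μ := by
        have hfour : (4 : ℝ≥0∞)⁻¹ ≠ ∞ := by finiteness
        simp only [evariance, hmean, enorm_integral_reflection_sub_sq,
          lintegral_const_mul' _ _ hfour]
    _ = 4⁻¹ * ∫⁻ x, eVar[h; μ] + ‖h x - μ[h]‖ₑ ^ 2 ∂μ := by
        rw [lintegral_lintegral_swap hmeas.aemeasurable]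
        simp only [hinner]
    _ = 4⁻¹ * (2 * eVar[h; μ]) := by
        rw [lintegral_add_left measurable_const, lintegral_const, measure_univ, mul_one, two_mul]
        rfl
    _ = 2⁻¹ * eVar[h; μ] := by
        rw [← mul_assoc]
        congr 1
        rw [← ENNReal.toReal_eq_toReal_iff' (by finiteness) (by finiteness)]
        norm_num

theorem hasAveragingGap_reflection : HasAveragingGap μ fairCoin μ reflection 2⁻¹ where
  measurable := measurable_reflection
  preserving := measurePreserving_reflection μ
  gap _ hh := (lintegral_evariance_reflection μ hh).le

end Reflection

section CircleFold

variable {T : ℝ}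

/-- The tent map `t ↦ 2‖t‖` of the circle, centred at `θ`: it folds the circle at `θ` and at the
antipode of `θ`, and stretches the resulting half circle onto the whole circle. -/
noncomputable def circleFold (θ x : AddCircle T) : AddCircle T := ((2 * ‖x - θ‖ : ℝ) : AddCircle T)

theorem lipschitzWith_circleFold (θ : AddCircle T) : LipschitzWith 2 (circleFold θ) := by
  refine LipschitzWith.of_dist_le_mul fun x y => ?_
  calc dist (circleFold θ x) (circleFold θ y)
      = ‖((2 * ‖x - θ‖ - 2 * ‖y - θ‖ : ℝ) : AddCircle T)‖ := by
        rw [dist_eq_norm, circleFold, circleFold, AddCircle.coe_sub]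
    _ ≤ |2 * ‖x - θ‖ - 2 * ‖y - θ‖| := QuotientAddGroup.norm_mk_le_norm
    _ = 2 * |‖x - θ‖ - ‖y - θ‖| := by rw [← mul_sub, abs_mul, abs_two]
    _ ≤ 2 * ‖(x - θ) - (y - θ)‖ := by gcongr; exact abs_norm_sub_norm_le _ _
    _ = 2 * dist x y := by rw [sub_sub_sub_cancel_right, dist_eq_norm]

theorem circleFold_reflection (θ : AddCircle T) (e : Bool) (x : AddCircle T) :
    circleFold θ (reflection θ e x) = circleFold θ x := by
  cases e
  · rfl
  · have hcentre : (2 : ℤ) • θ - x - θ = θ - x := by rw [two_zsmul]; abel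
    simp only [circleFold, reflection, if_true, hcentre, norm_sub_rev]

variable [Fact (0 < T)]

theorem map_two_mul_norm :
    (volume : Measure (AddCircle T)).map (fun x => 2 * ‖x‖) =
      volume.restrict (Set.Ioc (0 : ℝ) (0 + T)) := by
  have hmeas : Measurable fun x : AddCircle T => 2 * ‖x‖ := by fun_prop
  refine Measure.ext_of_Iic _ _ fun a => ?_
  have hball : (fun x : AddCircle T => 2 * ‖x‖) ⁻¹' Set.Iic a = Metric.closedBall 0 (a / 2) := by
    ext x
    simp [le_div_iff₀' (zero_lt_two' ℝ)]
  rw [Measure.map_apply hmeas measurableSet_Iic, hball, AddCircle.volume_closedBall,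
    Measure.restrict_apply measurableSet_Iic, Set.inter_comm, Set.Ioc_inter_Iic, Real.volume_Ioc]
  ring_nf

theorem measurePreserving_circleFold (θ : AddCircle T) :
    MeasurePreserving (circleFold θ) volume volume := by
  have hnorm : MeasurePreserving (fun x : AddCircle T => 2 * ‖x‖) volume
      (volume.restrict (Set.Ioc (0 : ℝ) (0 + T))) := ⟨by fun_prop, map_two_mul_norm⟩
  exact (AddCircle.measurePreserving_mk T 0).comp
    (hnorm.comp (measurePreserving_sub_right volume θ))

end CircleFold

instance isProbabilityMeasure_volume_unitAddCircle :
    IsProbabilityMeasure (volume : Measure UnitAddCircle) :=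
  ⟨UnitAddCircle.measure_univ⟩

theorem isRandomFold_circleFold :
    IsRandomFold (volume : Measure UnitAddCircle) fairCoin (volume : Measure UnitAddCircle)
      reflection circleFold 2⁻¹ 2 where
  toHasAveragingGap := hasAveragingGap_reflection _
  fold_preserving := measurePreserving_circleFold
  lipschitzWith := lipschitzWith_circleFold
  fold_apply := circleFold_reflection

section PiLpPower

variable {p : ℝ≥0∞} [Fact (1 ≤ p)]

theorem lipschitzWith_piLp_map {ι M : Type*} [Fintype ι] [PseudoEMetricSpace M] {L : NNReal}
    {T : M → M} (hT : LipschitzWith L T) :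
    LipschitzWith L fun x : PiLp p (fun _ : ι => M) => WithLp.toLp p fun i => T (x i) := by
  intro x y
  rcases eq_or_ne p ∞ with rfl | hp
  · simp only [PiLp.edist_eq_iSup, ENNReal.mul_iSup]
    exact iSup_mono fun i => hT _ _
  · have hpos : 0 < p.toReal := ENNReal.toReal_pos (one_pos.trans_le Fact.out).ne' hp
    rw [PiLp.edist_eq_sum hpos, PiLp.edist_eq_sum hpos, one_div, ENNReal.rpow_inv_le_iff hpos,
      ENNReal.mul_rpow_of_nonneg _ _ hpos.le, ENNReal.rpow_inv_rpow hpos.ne', Finset.mul_sum]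
    simp only [← ENNReal.mul_rpow_of_nonneg _ _ hpos.le]
    gcongr
    exact hT _ _

theorem IsRandomFold.piLp {Θ E M : Type*} [MeasurableSpace Θ] [MeasurableSpace E]
    [PseudoEMetricSpace M] [MeasurableSpace M] {ν : Measure Θ} {τ : Measure E} {μ : Measure M}
    [SFinite ν] [IsProbabilityMeasure τ] [IsProbabilityMeasure μ] {R : Θ → E → M → M}
    {T : Θ → M → M} {c : ℝ≥0∞} {L : NNReal} (hT : IsRandomFold ν τ μ R T c L) {d : ℕ}
    {μ' : Measure (PiLp p fun _ : Fin d => M)}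
    (hμ' : MeasurePreserving (MeasurableEquiv.toLp p (Fin d → M)).symm μ' (Measure.pi fun _ => μ)) :
    IsRandomFold ν (Measure.pi fun _ : Fin d => τ) μ'
      (fun θ e x => WithLp.toLp p fun i => R θ (e i) (x i))
      (fun θ x => WithLp.toLp p fun i => T θ (x i)) c L where
  toHasAveragingGap := (hT.toHasAveragingGap.pi d).of_equiv hμ' (g := .refl _) (.id _)
  fold_preserving θ :=
    (hμ'.symm _).comp ((measurePreserving_pi _ _ fun _ => hT.fold_preserving θ).comp hμ')
  lipschitzWith θ := lipschitzWith_piLp_map (hT.lipschitzWith θ)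
  fold_apply θ e x := by simp only [hT.fold_apply]

end PiLpPower

instance torusHaar.isAddHaarMeasure (d : ℕ) : (torusHaar d).IsAddHaarMeasure :=
  Measure.isAddHaarMeasure_addHaarMeasure _

theorem measurePreserving_toLp_symm_torusHaar (d : ℕ) :
    MeasurePreserving (MeasurableEquiv.toLp 2 (Fin d → UnitAddCircle)).symm (torusHaar d)
      (Measure.pi fun _ => volume) := by
  set f := (MeasurableEquiv.toLp 2 (Fin d → UnitAddCircle)).symm
  have : IsProbabilityMeasure ((torusHaar d).map f) :=
    Measure.isProbabilityMeasure_map f.measurable.aemeasurable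
  have : ((torusHaar d).map f).IsAddHaarMeasure :=
    (WithLp.linearEquiv 2 ℤ (Fin d → UnitAddCircle)).toAddEquiv.isAddHaarMeasure_map (torusHaar d)
      (PiLp.continuous_ofLp 2 _) (PiLp.continuous_toLp 2 _)
  exact ⟨f.measurable, Measure.isAddHaarMeasure_eq_of_isProbabilityMeasure _ _⟩

instance infinite_unitAddCircle : Infinite UnitAddCircle :=
  have : Infinite (Set.Ico (0 : ℝ) (0 + 1)) := (Set.Ico_infinite (by norm_num)).to_subtype
  .of_injective _ (AddCircle.equivIco (1 : ℝ) 0).symm.injective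

theorem FlatTorus.infinite {d : ℕ} (hd : 1 ≤ d) : Infinite (FlatTorus d) :=
  have : Nonempty (Fin d) := ⟨⟨0, hd⟩⟩
  .of_injective _ (WithLp.toLp_injective 2 (V := Fin d → UnitAddCircle))

theorem theorem2 (d : ℕ) (hd : 1 ≤ d) : AdmitsThresholds (FlatTorus d) (torusHaar d) :=
  have := FlatTorus.infinite hd
  (isRandomFold_circleFold.piLp (measurePreserving_toLp_symm_torusHaar d)).admitsThresholds
    (by simp) (by simp) two_pos
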